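/- For positive integers $r,m$ let $\sigma_r(m)=\sum_{d\mid m,\ d\ge 1}d^r$, put $\sigma_r(x)=0$ if $x$ is a rational number that is not a positive integer, and write $\sigma=\sigma_1$. For positive integers $a,b,r,s,n$ let $$W^{r,s}_{a,b}(n)=\sum_{\substack{l,m\ge 1\\ al+bm=n}}\sigma_r(l)\,\sigma_s(m).$$ Let $M_w(N)$ denote the finite-dimensional complex vector space of modular forms of weight $w$ on $\Gamma_0(N)$, let $\lambda_w(N)$ be its dimension, and let $B_k$ be the $k$-th Bernoulli number. Let $k\ge 4$ be an even integer and let $a,b$ be relatively prime positive integers. Let $f_1,\dots,f_\lambda$, where $\lambda=\lambda_{k+2}(ab)$, be any basis of $M_{k+2}(ab)$, and let $a_i(n)$ be the $n$-th Fourier coefficient of $f_i$, so that $f_i(z)=\sum_{n\ge 0}a_i(n)e^{2\pi i nz}$ (the $i$ in the exponent being the imaginary unit). Then there exist constants $\alpha_1,\dots,\alpha_\lambda\in\mathbb C$, independent of $n$, such that for every integer $n\ge 1$ $$W^{1,k-1}_{a,b}(n)=\frac{B_k}{2k}\,\sigma(n/a)+\Bigl(\frac1{24}-\frac{n}{2ka}\Bigr)\sigma_{k-1}(n/b)-\frac{B_k}{4ak^2}\sum_{i=1}^{\lambda}\alpha_i\,a_i(n).$$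 -/

import Mathlib

/-- The divisor function `σ_r(x) = ∑_{d ∣ x, d ≥ 1} d ^ r`, extended to rational arguments by
`σ_r(x) = 0` if `x` is not a positive integer. (For `x` an integer, `x.num = x`;
`Int.toNat` sends negative integers to `0`, and `ArithmeticFunction.sigma r 0 = 0`.) -/
def divSigma (r : ℕ) (x : ℚ) : ℕ :=
  if x.den = 1 then ArithmeticFunction.sigma r x.num.toNat else 0

/-- The convolution sum `W^{r,s}_{a,b}(n) = ∑_{l, m ≥ 1, a l + b m = n} σ_r(l) σ_s(m)`,
for positive integers `a` and `b`. The solutions `(l, m)` satisfy `l, m ≤ n`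
because `a` and `b` are positive, so the box `1 ≤ l, m ≤ n` contains all of them. -/
def convSum (r s a b n : ℕ) : ℕ :=
  ∑ p ∈ (Finset.Icc 1 n ×ˢ Finset.Icc 1 n).filter (fun p => a * p.1 + b * p.2 = n),
    ArithmeticFunction.sigma r p.1 * ArithmeticFunction.sigma s p.2

/-- The complex vector space `M_k(N)` of modular forms of weight `k` on `Γ₀(N)`. -/
abbrev ModFormSpace (k N : ℕ) : Type :=
  ModularForm ((CongruenceSubgroup.Gamma0 N).map (Matrix.SpecialLinearGroup.mapGL ℝ)) (k : ℤ)

/-- The dimension `λ_k(N)` of `M_k(N)` over `ℂ`. -/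
noncomputable def modFormDim (k N : ℕ) : ℕ :=
  Module.finrank ℂ (ModFormSpace k N)

/-- The `n`-th Fourier coefficient `a_f(n)` of a form `f(z) = ∑_{n ≥ 0} a_f(n) e^{2πinz}`
in `M_k(N)`. -/
noncomputable def fourierCoeffAt {k N : ℕ} (f : ModFormSpace k N) (n : ℕ) : ℂ :=
  (UpperHalfPlane.qExpansion 1 f).coeff n

/-!
Let `g(z) = E_k(bz)`. Conjugation by `diag(a, 1)` turns the Serre derivative `D - (k / 12) E₂` into
`D - (k / 12) a E₂(az)`, and it carries `Γ₀(N)` into `SL(2, ℤ)` when `a ∣ N`. Hence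
`F = D g - (k / 12) a E₂(az) g` is a modular form of weight `k + 2` on `Γ₀(N)` as soon as `a` and
`b` divide `N`. The product `E₂(az) E_k(bz)` contributes the convolution sum to the `n`-th Fourier
coefficient of `F`, all other contributions being values of divisor functions, so that expanding `F`
in the given basis is the asserted formula.
-/

section

open UpperHalfPlane hiding I
open Complex Matrix.SpecialLinearGroup CongruenceSubgroup EisensteinSeries Derivative
open ArithmeticFunction (sigma)
open PowerSeries (expand)
open ConjAct (toConjAct)
open scoped Manifold MatrixGroups ModularForm Real Topology Pointwise PowerSeries

local notation "𝕢" => Function.Periodic.qParam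

theorem isBoundedAtImInfty_normalizedDeriv {f : ℍ → ℂ} (hf : MDiff f)
    (hb : IsBoundedAtImInfty f) : IsBoundedAtImInfty (normalizedDerivOfComplex f) := by
  rw [isBoundedAtImInfty_iff] at hb ⊢
  obtain ⟨M, A, hM⟩ := hb
  rw [UpperHalfPlane.mdifferentiable_iff] at hf
  refine ⟨‖(2 * π * I : ℂ)⁻¹‖ * M, max A 0 + 2, fun z hz ↦ ?_⟩
  have im_gt : ∀ w ∈ Metric.closedBall (z : ℂ) 1, max A 0 < w.im := fun w hw ↦ by
    have him := (Complex.abs_im_le_norm (w - z)).trans (mem_closedBall_iff_norm.mp hw)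
    rw [abs_le, sub_im, coe_im] at him
    linarith
  have hdiff : DiffContOnCl ℂ (f ∘ ofComplex) (Metric.ball (z : ℂ) 1) :=
    (hf.mono fun w hw ↦ (le_max_right A 0).trans_lt (im_gt w hw)).diffContOnCl_ball subset_rfl
  have hbound : ∀ w ∈ Metric.sphere (z : ℂ) 1, ‖(f ∘ ofComplex) w‖ ≤ M := fun w hw ↦ by
    have hw' := max_lt_iff.mp (im_gt w (Metric.sphere_subset_closedBall hw))
    rw [Function.comp_apply, ofComplex_apply_of_im_pos hw'.2]
    exact hM _ hw'.1.le
  have cauchy := Complex.norm_deriv_le_of_forall_mem_sphere_norm_le one_pos hdiff hbound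
  rw [div_one] at cauchy
  rw [normalizedDerivOfComplex, norm_mul]
  gcongr

theorem isBoundedAt_serreDerivative {f : ℍ → ℂ} (hf : MDiff f) {k : ℤ} {c : OnePoint ℝ}
    (hc : IsCusp c 𝒮ℒ) (hb : c.IsBoundedAt f k) : c.IsBoundedAt (serreDerivative k f) (k + 2) := by
  rw [OnePoint.isBoundedAt_iff_forall_SL2Z hc] at hb ⊢
  intro γ hγ
  rw [serreDerivative_slash_equivariant hf]
  exact (isBoundedAtImInfty_normalizedDeriv (hf.slash k _) (hb γ hγ)).sub
    (((Filter.const_boundedAtFilter _ _).mul isBoundedAtImInfty_E2).mul (hb γ hγ))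

section Forms

variable {Γ Γ' : Subgroup (GL (Fin 2) ℝ)} {k : ℤ}

/-- A modular form for `Γ`, regarded as a modular form for a subgroup `Γ'` of `Γ`. -/
noncomputable def restrictLevel (f : ModularForm Γ k) (h : Γ' ≤ Γ) : ModularForm Γ' k where
  toFun := f
  slash_action_eq' γ hγ := SlashInvariantForm.slash_action_eqn f γ (h hγ)
  holo' := ModularFormClass.holo f
  bdd_at_cusps' hc := ModularFormClass.bdd_at_cusps f (hc.mono h)

/-- The Serre derivative `D f - (k / 12) E₂ f` of a modular form `f` of weight `k`, as a modular
form of weight `k + 2`. -/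
noncomputable def serreDerivativeForm (f : ModularForm Γ k) (h : Γ ≤ 𝒮ℒ) :
    ModularForm Γ (k + 2) where
  toFun := serreDerivative k f
  slash_action_eq' γ hγ := by
    obtain ⟨γ', rfl⟩ := h hγ
    exact serreDerivative_slash_invariant (ModularFormClass.holo f)
      (SlashInvariantForm.slash_action_eqn f _ hγ)
  holo' := serreDerivative_mdifferentiable k (ModularFormClass.holo f)
  bdd_at_cusps' hc := isBoundedAt_serreDerivative (ModularFormClass.holo f) (hc.mono h)
    (ModularFormClass.bdd_at_cusps f hc)

variable (d : ℕ) [NeZero d]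

/-- The matrix `diag(d, 1)`, which acts on the upper half-plane as `z ↦ d z`. -/
noncomputable def dilation : GL (Fin 2) ℝ :=
  Matrix.GeneralLinearGroup.mkOfDetNeZero !![(d : ℝ), 0; 0, 1] (by simp [NeZero.ne d])

theorem val_dilation : (dilation d).val = !![(d : ℝ), 0; 0, 1] := rfl

theorem val_det_dilation : (dilation d).val.det = d := by
  simp [val_dilation]

theorem val_det_dilation_pos : 0 < (dilation d).val.det := by
  rw [val_det_dilation]
  exact_mod_cast NeZero.pos d

theorem denom_dilation (z : ℂ) : denom (dilation d) z = 1 := by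
  simp [denom, val_dilation]

theorem coe_dilation_smul (z : ℍ) : ((dilation d • z : ℍ) : ℂ) = d * z := by
  rw [UpperHalfPlane.coe_smul_of_det_pos (val_det_dilation_pos d), denom_dilation]
  simp [num, val_dilation]

theorem slash_dilation_apply (f : ℍ → ℂ) (z : ℍ) :
    (f ∣[k] dilation d) z = (d : ℂ) ^ (k - 1) * f (dilation d • z) := by
  have hσ : UpperHalfPlane.σ (dilation d) (f (dilation d • z)) = f (dilation d • z) := by
    rw [UpperHalfPlane.σ, Matrix.GeneralLinearGroup.val_det_apply, if_pos (val_det_dilation_pos d)]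
    rfl
  rw [ModularForm.slash_apply, hσ, denom_dilation, Matrix.GeneralLinearGroup.val_det_apply,
    val_det_dilation]
  simp [mul_comm]

theorem toConjAct_dilation_smul_Gamma0_le {d N : ℕ} [NeZero d] (hdN : d ∣ N) :
    toConjAct (dilation d) • (Gamma0 N).map (mapGL ℝ) ≤ 𝒮ℒ := by
  rintro _ ⟨_, ⟨γ, hγ, rfl⟩, rfl⟩
  rw [SetLike.mem_coe, Gamma0_mem, ZMod.intCast_zmod_eq_zero_iff_dvd] at hγ
  obtain ⟨c, hc⟩ := (Int.natCast_dvd_natCast.mpr hdN).trans hγ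
  have hdet : Matrix.det !![γ 0 0, d * γ 0 1; c, γ 1 1] = 1 := by
    have hγ' := γ.2
    rw [Matrix.det_fin_two, hc] at hγ'
    rw [Matrix.det_fin_two_of]
    linarith
  obtain ⟨γ', h00, h01, h10, h11⟩ : ∃ γ' : SL(2, ℤ),
      γ' 0 0 = γ 0 0 ∧ γ' 0 1 = d * γ 0 1 ∧ γ' 1 0 = c ∧ γ' 1 1 = γ 1 1 :=
    ⟨⟨_, hdet⟩, rfl, rfl, rfl, rfl⟩
  refine ⟨γ', ?_⟩
  simp only [MulDistribMulAction.toMonoidEnd_apply, MulDistribMulAction.toMonoidHom_apply,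
    ConjAct.toConjAct_smul]
  rw [eq_mul_inv_iff_mul_eq]
  have hc' : (γ 1 0 : ℝ) = d * c := by exact_mod_cast hc
  ext i j
  fin_cases i <;> fin_cases j <;>
    simp [val_dilation, Matrix.mul_apply, hc', h00, h01, h10, h11, mul_comm]

/-- The form `z ↦ f (d z)` for a group that `diag(d, 1)` conjugates into `Γ`. The scalar cancels
the factor `d ^ (k - 1)` of the slash action; it is real since modular forms for an arbitrary
subgroup of `GL₂(ℝ)` are only a real vector space. -/
noncomputable def levelRaise (f : ModularForm Γ k) (h : toConjAct (dilation d) • Γ' ≤ Γ) :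
    ModularForm Γ' k :=
  (d : ℝ) ^ (1 - k) • (restrictLevel (ModularForm.translate f (dilation d))
    (by rwa [map_inv, ← Subgroup.pointwise_smul_subset_iff]) : ModularForm Γ' k)

theorem levelRaise_apply (f : ModularForm Γ k) (h : toConjAct (dilation d) • Γ' ≤ Γ) (z : ℍ) :
    levelRaise d f h z = f (dilation d • z) := by
  have hd : (d : ℂ) ≠ 0 := NeZero.ne _
  calc levelRaise d f h z = (d : ℝ) ^ (1 - k) • (⇑f ∣[k] dilation d) z := rfl
    _ = (d : ℂ) ^ (1 - k) * ((d : ℂ) ^ (k - 1) * f (dilation d • z)) := by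
      simp only [slash_dilation_apply, real_smul, ofReal_zpow, ofReal_natCast]
    _ = f (dilation d • z) := by
      rw [← mul_assoc, ← zpow_add₀ hd, sub_add_sub_cancel', sub_self, zpow_zero, one_mul]

theorem normalizedDeriv_slash_dilation {f : ℍ → ℂ} (hf : MDiff f) (z : ℍ) :
    normalizedDerivOfComplex (f ∣[k] dilation d) z =
      (d : ℂ) ^ k * normalizedDerivOfComplex f (dilation d • z) := by
  have hd : (d : ℂ) ≠ 0 := NeZero.ne _
  rw [congrFun (normalizedDerivOfComplex_slash hf (val_det_dilation_pos d)) z]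
  have h10 : (dilation d) 1 0 = 0 := rfl
  simp only [h10, slash_dilation_apply, val_det_dilation, ofReal_zero, zero_div, mul_zero,
    zero_mul, sub_zero, ofReal_natCast]
  rw [show k + 2 - 1 = k + 1 by ring, zpow_add_one₀ hd]
  field

theorem serreDerivative_slash_dilation {f : ℍ → ℂ} (hf : MDiff f) (z : ℍ) :
    (serreDerivative k f ∣[k + 2] dilation d) z =
      d * (normalizedDerivOfComplex (f ∣[k] dilation d) z
        - k / 12 * d * E2 (dilation d • z) * (f ∣[k] dilation d) z) := by
  have hd : (d : ℂ) ≠ 0 := NeZero.ne _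
  rw [normalizedDeriv_slash_dilation d hf, slash_dilation_apply, slash_dilation_apply,
    serreDerivative_apply, show k + 2 - 1 = k + 1 by ring, zpow_add_one₀ hd, zpow_sub_one₀ hd]
  field

/-- The form `D f - (k / 12) d E₂(d z) f` of weight `k + 2`, obtained from the Serre derivative by
conjugation with `diag(d, 1)`. -/
noncomputable def twistedSerreDerivative (f : ModularForm Γ k)
    (h : toConjAct (dilation d) • Γ ≤ 𝒮ℒ) : ModularForm Γ (k + 2) :=
  (d : ℝ)⁻¹ • (restrictLevel (ModularForm.translate (serreDerivativeForm
      (ModularForm.translate f (dilation d)⁻¹) (by rwa [inv_inv])) (dilation d))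
    (by rw [map_inv, inv_inv, inv_smul_smul]) : ModularForm Γ (k + 2))

theorem twistedSerreDerivative_apply (f : ModularForm Γ k) (h : toConjAct (dilation d) • Γ ≤ 𝒮ℒ)
    (z : ℍ) : twistedSerreDerivative d f h z =
      normalizedDerivOfComplex f z - k / 12 * d * E2 (dilation d • z) * f z := by
  have hd : (d : ℂ) ≠ 0 := NeZero.ne _
  have hslash : (⇑f ∣[k] (dilation d)⁻¹) ∣[k] dilation d = f := by
    rw [← SlashAction.slash_mul, inv_mul_cancel, SlashAction.slash_one]
  calc twistedSerreDerivative d f h z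
      = (d : ℝ)⁻¹ • (serreDerivative k (⇑f ∣[k] (dilation d)⁻¹) ∣[k + 2] dilation d) z := rfl
    _ = _ := by
      rw [serreDerivative_slash_dilation d ((ModularFormClass.holo f).slash k _), hslash,
        real_smul, ofReal_inv, ofReal_natCast, inv_mul_cancel_left₀ hd]

end Forms

/-- The function `f` on the upper half-plane is given by the `q`-series `p`, that is,
`f z = ∑ pₙ qⁿ` with `q = exp (2πiz)` for every `z`. Convergence is part of the predicate, so
sums, products and derivatives of expansions need no side conditions. -/
def HasQExpansion (f : ℍ → ℂ) (p : ℂ⟦X⟧) : Prop :=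
  ∀ z : ℍ, HasSum (fun n ↦ p.coeff n * 𝕢 1 z ^ n) (f z)

theorem qParam_dilation_smul (d : ℕ) [NeZero d] (z : ℍ) : 𝕢 1 (dilation d • z : ℍ) = 𝕢 1 z ^ d := by
  rw [coe_dilation_smul, Function.Periodic.qParam, Function.Periodic.qParam, ← Complex.exp_nat_mul]
  ring_nf

theorem hasDerivAt_qParam_pow (n : ℕ) (w : ℂ) :
    HasDerivAt (fun w ↦ 𝕢 1 w ^ n) (2 * π * I * (n * 𝕢 1 w ^ n)) w := by
  have hexp : HasDerivAt (fun w : ℂ ↦ cexp (n * (2 * π * I * w)))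
      (cexp (n * (2 * π * I * w)) * (n * (2 * π * I * 1))) w :=
    (((hasDerivAt_id w).const_mul _).const_mul _).cexp
  have hq (w : ℂ) : 𝕢 1 w ^ n = cexp (n * (2 * π * I * w)) := by
    rw [Function.Periodic.qParam, ← Complex.exp_nat_mul, ofReal_one, div_one]
  simp only [hq]
  convert hexp using 1
  ring

theorem norm_qParam_le_of_im_le {z w : ℂ} (h : z.im ≤ w.im) : ‖𝕢 1 w‖ ≤ ‖𝕢 1 z‖ := by
  simp only [Function.Periodic.norm_qParam, div_one, Real.exp_le_exp]
  exact mul_le_mul_of_nonpos_left h (by linarith [Real.pi_pos])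

theorem coeff_X_mul_derivative {R : Type*} [CommSemiring R] (p : R⟦X⟧) (n : ℕ) :
    (PowerSeries.X * d⁄dX R p).coeff n = n * p.coeff n := by
  cases n with
  | zero => simp
  | succ n =>
    rw [PowerSeries.coeff_succ_X_mul, PowerSeries.coeff_derivative, mul_comm, Nat.cast_succ]

namespace HasQExpansion

variable {f g : ℍ → ℂ} {p q : ℂ⟦X⟧}

theorem sub (hf : HasQExpansion f p) (hg : HasQExpansion g q) :
    HasQExpansion (fun z ↦ f z - g z) (p - q) := fun z ↦ by
  simpa only [map_sub, sub_mul] using (hf z).sub (hg z)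

theorem const_mul (c : ℂ) (hf : HasQExpansion f p) : HasQExpansion (fun z ↦ c * f z) (c • p) :=
  fun z ↦ by simpa only [PowerSeries.coeff_smul, smul_eq_mul, mul_assoc] using (hf z).mul_left c

theorem mul (hf : HasQExpansion f p) (hg : HasQExpansion g q) :
    HasQExpansion (fun z ↦ f z * g z) (p * q) := fun z ↦ by
  beta_reduce
  have cauchy := tsum_mul_tsum_eq_tsum_sum_antidiagonal_of_summable_norm (hf z).summable.norm
    (hg z).summable.norm
  rw [(hf z).tsum_eq, (hg z).tsum_eq] at cauchy
  rw [cauchy]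
  refine (summable_norm_sum_mul_antidiagonal_of_summable_norm (hf z).summable.norm
    (hg z).summable.norm).of_norm.hasSum.congr_fun fun n ↦ ?_
  rw [PowerSeries.coeff_mul, Finset.sum_mul]
  refine Finset.sum_congr rfl fun m hm ↦ ?_
  rw [← Finset.HasAntidiagonal.mem_antidiagonal.mp hm, pow_add]
  ring

theorem comp_dilation (d : ℕ) [NeZero d] (hf : HasQExpansion f p) :
    HasQExpansion (fun z ↦ f (dilation d • z)) (expand d (NeZero.ne d) p) := fun z ↦ by
  rw [← (mul_right_injective₀ (NeZero.ne d)).hasSum_iff]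
  · convert hf (dilation d • z) using 2 with n
    rw [Function.comp_apply, PowerSeries.coeff_expand_mul, qParam_dilation_smul, pow_mul]
  · intro n hn
    have hdn : ¬ d ∣ n := fun ⟨m, hm⟩ ↦ hn ⟨m, hm.symm⟩
    rw [PowerSeries.coeff_expand_of_not_dvd _ _ _ hdn, zero_mul]

theorem normalizedDeriv (hf : HasQExpansion f p) :
    HasQExpansion (normalizedDerivOfComplex f) (PowerSeries.X * d⁄dX ℂ p) := fun z ↦ by
  set U : Set ℂ := {w | z.im / 2 < w.im}
  have hU : IsOpen U := isOpen_lt continuous_const Complex.continuous_im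
  have im_pos : ∀ w ∈ U, 0 < w.im := fun w hw ↦ (half_pos z.im_pos).trans hw
  have hzU : (z : ℂ) ∈ U := half_lt_self z.im_pos
  set z' : ℍ := ⟨z.im / 2 * I, by simpa using z.im_pos⟩
  have hderiv (n : ℕ) (w : ℂ) := (hasDerivAt_qParam_pow n w).const_mul (p.coeff n)
  have hsum : HasSum (fun n ↦ deriv (fun w ↦ p.coeff n * 𝕢 1 w ^ n) z)
      (deriv (fun w : ℂ ↦ ∑' n, p.coeff n * 𝕢 1 w ^ n) z) := by
    refine hasSum_deriv_of_summable_norm (hf z').summable.norm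
      (fun n w _ ↦ (hderiv n w).differentiableAt.differentiableWithinAt) hU (fun n w hw ↦ ?_) hzU
    rw [norm_mul, norm_mul, norm_pow, norm_pow]
    gcongr ‖p.coeff n‖ * ?_ ^ n
    exact norm_qParam_le_of_im_le (by simpa [z'] using le_of_lt hw)
  have heq : f ∘ ofComplex =ᶠ[𝓝 (z : ℂ)] fun w ↦ ∑' n, p.coeff n * 𝕢 1 w ^ n := by
    filter_upwards [hU.mem_nhds hzU] with w hw
    rw [Function.comp_apply, ofComplex_apply_of_im_pos (im_pos w hw)]
    exact (hf ⟨w, im_pos w hw⟩).tsum_eq.symm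
  rw [normalizedDerivOfComplex, heq.deriv_eq]
  refine (hsum.mul_left (2 * π * I : ℂ)⁻¹).congr_fun fun n ↦ ?_
  rw [(hderiv n z).deriv, mul_left_comm, inv_mul_cancel_left₀ two_pi_I_ne_zero,
    coeff_X_mul_derivative]
  ring

theorem fourierCoeffAt_eq {k N : ℕ} {f : ModFormSpace k N} (hf : HasQExpansion f p) (n : ℕ) :
    fourierCoeffAt f n = p.coeff n :=
  (ModularFormClass.qExpansion_coeff_unique one_pos (by simp) hf n).symm

end HasQExpansion

/-- The generating series `∑ σ_r(n) qⁿ`, over `n ≥ 1`, of the divisor function. -/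
noncomputable def sigmaSeries (r : ℕ) : ℂ⟦X⟧ :=
  PowerSeries.mk fun n ↦ (sigma r n : ℂ)

theorem hasQExpansion_E2 : HasQExpansion E2 (1 - (24 : ℂ) • sigmaSeries 1) := fun z ↦ by
  convert hasSum_qExpansion_E2 (z := z) using 2 with n
  rcases eq_or_ne n 0 with rfl | hn
  · simp [sigmaSeries]
  · simp [sigmaSeries, PowerSeries.coeff_one, hn, Function.Periodic.qParam]

theorem hasQExpansion_E {k : ℕ} (hk : 3 ≤ k) (hk2 : Even k) :
    HasQExpansion (ModularForm.E hk)
      (1 - (2 * k / bernoulli k : ℂ) • sigmaSeries (k - 1)) := fun z ↦ by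
  convert ModularForm.hasSum_qExpansion (ModularForm.E hk) one_pos (by simp) z using 3 with n
  rw [EisensteinSeries.E_qExpansion_coeff hk hk2]
  rcases eq_or_ne n 0 with rfl | hn
  · simp [sigmaSeries]
  · simp [sigmaSeries, PowerSeries.coeff_one, hn]

theorem HasQExpansion.levelRaise {Γ Γ' : Subgroup (GL (Fin 2) ℝ)} {k : ℤ} {f : ModularForm Γ k}
    {p : ℂ⟦X⟧} (hf : HasQExpansion f p) (d : ℕ) [NeZero d] (h : toConjAct (dilation d) • Γ' ≤ Γ) :
    HasQExpansion (levelRaise d f h) (expand d (NeZero.ne d) p) := fun z ↦ by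
  simpa only [levelRaise_apply] using hf.comp_dilation d z

theorem HasQExpansion.twistedSerreDerivative {Γ : Subgroup (GL (Fin 2) ℝ)} {k : ℤ}
    {f : ModularForm Γ k} {p : ℂ⟦X⟧} (hf : HasQExpansion f p) (d : ℕ) [NeZero d]
    (h : toConjAct (dilation d) • Γ ≤ 𝒮ℒ) :
    HasQExpansion (twistedSerreDerivative d f h) (PowerSeries.X * d⁄dX ℂ p -
      (k / 12 * d : ℂ) • (expand d (NeZero.ne d) (1 - (24 : ℂ) • sigmaSeries 1) * p)) := fun z ↦ by
  rw [twistedSerreDerivative_apply, mul_assoc _ (E2 _)]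
  exact (hf.normalizedDeriv.sub (((hasQExpansion_E2.comp_dilation d).mul hf).const_mul _)) z

theorem divSigma_natCast_div (r n : ℕ) {d : ℕ} (hd : d ≠ 0) :
    divSigma r ((n : ℚ) / d) = if d ∣ n then sigma r (n / d) else 0 := by
  simp only [divSigma, Rat.den_div_natCast_eq_one_iff n d hd]
  split_ifs with h
  · obtain ⟨m, rfl⟩ := h
    rw [Nat.cast_mul, mul_div_cancel_left₀ _ (by exact_mod_cast hd : (d : ℚ) ≠ 0),
      Nat.mul_div_cancel_left m (Nat.pos_of_ne_zero hd)]
    rfl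
  · rfl

theorem coeff_expand_sigmaSeries (r n : ℕ) {d : ℕ} (hd : d ≠ 0) :
    (expand d hd (sigmaSeries r)).coeff n = divSigma r ((n : ℚ) / d) := by
  rw [PowerSeries.coeff_expand, divSigma_natCast_div r n hd]
  split_ifs <;> simp [sigmaSeries]

theorem exists_pos_eq_mul_of_coeff_expand_sigmaSeries_ne_zero {r d n : ℕ} (hd : d ≠ 0)
    (h : (expand d hd (sigmaSeries r)).coeff n ≠ 0) : ∃ m, 0 < m ∧ n = d * m := by
  by_cases hdn : d ∣ n
  · obtain ⟨m, rfl⟩ := hdn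
    refine ⟨m, Nat.pos_of_ne_zero ?_, rfl⟩
    rintro rfl
    simp [PowerSeries.coeff_expand, sigmaSeries] at h
  · exact absurd (PowerSeries.coeff_expand_of_not_dvd d hd _ hdn) h

theorem coeff_expand_sigmaSeries_mul (r s n : ℕ) {a b : ℕ} (ha : a ≠ 0) (hb : b ≠ 0) :
    (expand a ha (sigmaSeries r) * expand b hb (sigmaSeries s)).coeff n = convSum r s a b n := by
  rw [PowerSeries.coeff_mul, convSum, Nat.cast_sum]
  refine (Finset.sum_of_injOn (fun p ↦ (a * p.1, b * p.2)) ?_ ?_ ?_ ?_).symm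
  · exact ((mul_right_injective₀ ha).prodMap (mul_right_injective₀ hb)).injOn
  · rintro ⟨l, m⟩ h
    simpa using (Finset.mem_filter.mp h).2
  · rintro ⟨x, y⟩ hxy hni
    by_contra hne
    obtain ⟨l, hl, rfl⟩ :=
      exists_pos_eq_mul_of_coeff_expand_sigmaSeries_ne_zero ha (left_ne_zero_of_mul hne)
    obtain ⟨m, hm, rfl⟩ :=
      exists_pos_eq_mul_of_coeff_expand_sigmaSeries_ne_zero hb (right_ne_zero_of_mul hne)
    have hn : a * l + b * m = n := Finset.HasAntidiagonal.mem_antidiagonal.mp hxy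
    have hln := Nat.le_mul_of_pos_left l (Nat.pos_of_ne_zero ha)
    have hmn := Nat.le_mul_of_pos_left m (Nat.pos_of_ne_zero hb)
    refine hni ⟨(l, m), ?_, rfl⟩
    simp only [Finset.coe_filter, Finset.mem_product, Finset.mem_Icc, Set.mem_ofPred_eq]
    lia
  · rintro ⟨l, m⟩ -
    simp only [PowerSeries.coeff_expand_mul, sigmaSeries, PowerSeries.coeff_mk, Nat.cast_mul]

theorem bernoulli_ne_zero_of_even {k : ℕ} (hk : Even k) : bernoulli k ≠ 0 := by
  obtain ⟨m, rfl⟩ := even_iff_exists_two_mul.mp hk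
  rcases eq_or_ne m 0 with rfl | hm
  · simp
  intro h
  have hzeta := riemannZeta_two_mul_nat hm
  rw [h] at hzeta
  refine riemannZeta_ne_zero_of_one_lt_re (s := 2 * m) ?_ (by simpa using hzeta)
  norm_cast
  lia

theorem coeff_twistedSerreDerivative_eisenstein (β κ : ℂ) (r : ℕ) {a b n : ℕ} (ha : a ≠ 0)
    (hb : b ≠ 0) (hn : n ≠ 0) :
    (PowerSeries.X * d⁄dX ℂ (expand b hb (1 - β • sigmaSeries r)) -
      κ • (expand a ha (1 - (24 : ℂ) • sigmaSeries 1) *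
        expand b hb (1 - β • sigmaSeries r))).coeff n =
      κ * (24 * divSigma 1 ((n : ℚ) / a) + β * divSigma r ((n : ℚ) / b)
        - 24 * β * convSum 1 r a b n) - n * (β * divSigma r ((n : ℚ) / b)) := by
  have hprod : expand a ha (1 - (24 : ℂ) • sigmaSeries 1) * expand b hb (1 - β • sigmaSeries r) =
      1 - (24 : ℂ) • expand a ha (sigmaSeries 1) - β • expand b hb (sigmaSeries r)
        + (24 * β) • (expand a ha (sigmaSeries 1) * expand b hb (sigmaSeries r)) := by
    simp only [map_sub, map_one, PowerSeries.expand_smul, sub_mul, mul_sub, one_mul, mul_one,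
      smul_mul_smul_comm]
    abel
  rw [hprod, map_sub, coeff_X_mul_derivative]
  simp only [map_sub, map_add, map_one, PowerSeries.expand_smul, PowerSeries.coeff_smul,
    PowerSeries.coeff_one, hn, if_false, coeff_expand_sigmaSeries, coeff_expand_sigmaSeries_mul,
    smul_eq_mul]
  ring

/-- The `n`-th Fourier coefficient as a linear functional on `M_k(N)`. -/
noncomputable def fourierCoeffLinear {k N : ℕ} (n : ℕ) : ModFormSpace k N →ₗ[ℂ] ℂ where
  toFun f := fourierCoeffAt f n
  map_add' f g := by
    simp only [fourierCoeffAt]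
    rw [FunLike.coe_add, ModularForm.qExpansion_add one_pos (by simp), map_add]
  map_smul' c f := by
    simp only [fourierCoeffAt]
    rw [FunLike.coe_smul, ModularForm.qExpansion_smul one_pos (by simp), PowerSeries.coeff_smul]
    rfl

theorem fourierCoeffAt_eq_sum_repr {k N : ℕ} {ι : Type*} [Fintype ι]
    (f : Module.Basis ι ℂ (ModFormSpace k N)) (F : ModFormSpace k N) (n : ℕ) :
    fourierCoeffAt F n = ∑ i, f.repr F i * fourierCoeffAt (f i) n := by
  have h := congrArg (fourierCoeffLinear n) (f.sum_repr F)
  rw [map_sum] at h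
  simp only [map_smul] at h
  exact h.symm

theorem corollary2p3_general {k a b N : ℕ} (hk : 4 ≤ k) (hkeven : Even k) (ha : 0 < a) (hb : 0 < b)
    (haN : a ∣ N) (hbN : b ∣ N) {ι : Type*} [Fintype ι]
    (f : Module.Basis ι ℂ (ModFormSpace (k + 2) N)) :
    ∃ α : ι → ℂ, ∀ n : ℕ, 0 < n →
      (convSum 1 (k - 1) a b n : ℂ) =
        (bernoulli k : ℂ) / (2 * (k : ℂ)) * (divSigma 1 ((n : ℚ) / (a : ℚ)) : ℂ)
        + (1 / 24 - (n : ℂ) / (2 * (k : ℂ) * (a : ℂ)))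
            * (divSigma (k - 1) ((n : ℚ) / (b : ℚ)) : ℂ)
        - (bernoulli k : ℂ) / (4 * (a : ℂ) * (k : ℂ) ^ 2)
            * ∑ i, α i * fourierCoeffAt (f i) n := by
  have : NeZero a := ⟨ha.ne'⟩
  have : NeZero b := ⟨hb.ne'⟩
  have hk3 : 3 ≤ k := by lia
  let F : ModFormSpace (k + 2) N := twistedSerreDerivative a
    (levelRaise b (ModularForm.E hk3) (toConjAct_dilation_smul_Gamma0_le hbN))
    (toConjAct_dilation_smul_Gamma0_le haN)
  have hF := ((hasQExpansion_E hk3 hkeven).levelRaise b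
    (toConjAct_dilation_smul_Gamma0_le hbN)).twistedSerreDerivative a
    (toConjAct_dilation_smul_Gamma0_le haN)
  refine ⟨f.repr F, fun n hn ↦ ?_⟩
  rw [← fourierCoeffAt_eq_sum_repr, HasQExpansion.fourierCoeffAt_eq (f := F) hF,
    coeff_twistedSerreDerivative_eisenstein _ _ _ ha.ne' hb.ne' hn.ne']
  have ha' : (a : ℂ) ≠ 0 := NeZero.ne _
  have hk' : (k : ℂ) ≠ 0 := by exact_mod_cast (by lia : k ≠ 0)
  have hB : (bernoulli k : ℂ) ≠ 0 := by exact_mod_cast bernoulli_ne_zero_of_even hkeven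
  push_cast
  field_simp
  ring

end

theorem corollary2p3 (k a b : ℕ) (hk : 4 ≤ k) (hkeven : Even k) (ha : 0 < a) (hb : 0 < b)
    (hab : Nat.Coprime a b)
    (f : Module.Basis (Fin (modFormDim (k + 2) (a * b))) ℂ (ModFormSpace (k + 2) (a * b))) :
    ∃ α : Fin (modFormDim (k + 2) (a * b)) → ℂ, ∀ n : ℕ, 0 < n →
      (convSum 1 (k - 1) a b n : ℂ) =
        (bernoulli k : ℂ) / (2 * (k : ℂ)) * (divSigma 1 ((n : ℚ) / (a : ℚ)) : ℂ)
        + (1 / 24 - (n : ℂ) / (2 * (k : ℂ) * (a : ℂ)))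
            * (divSigma (k - 1) ((n : ℚ) / (b : ℚ)) : ℂ)
        - (bernoulli k : ℂ) / (4 * (a : ℂ) * (k : ℂ) ^ 2)
            * ∑ i, α i * fourierCoeffAt (f i) n :=
  corollary2p3_general hk hkeven ha hb (dvd_mul_right a b) (dvd_mul_left b a) f
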